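/- Let $H$ be a non-zero complex Hilbert space and let $\mathbb{B}(H)$ be the algebra of bounded linear operators on $H$, with the operator norm and identity $I$. An idempotent is an operator $Q\in\mathbb{B}(H)$ with $Q^2=Q$; a projection is an operator $P\in\mathbb{B}(H)$ with $P^2=P=P^*$. Let $Q\in\mathbb{B}(H)$ be an idempotent, and let $P_0\in\mathbb{B}(H)$ be a projection such that $\|P_0-Q\|\le\|P-Q\|$ for every projection $P\in\mathbb{B}(H)$. Then $$\|I-P_0-Q\|=1+\|P_0-Q\|,$$ and this number is the maximum of $\|P-Q\|$ over all projections $P\in\mathbb{B}(H)$; that is, $\|P-Q\|\le\|I-P_0-Q\|$ for every projection $P$, and equality holds for some projection $P$. -/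

import Mathlib

/-! Put `S = 2Q - 1`, so `S² = 1`, with polar decomposition `S = UB`. Here `U` is a symmetry, so `P
= (1 + U)/2` is a projection and `2(P - Q) = U(1 - B)`, whence `2‖P₀ - Q‖ ≤ ‖S‖ - 1` by minimality.
The triangle inequality does the rest: `-S = (P₀ - Q) + (1 - P₀ - Q)`, and each `2R - 1` has norm 1.
-/

/-- The unitary part of the polar decomposition of an involution `S` is self-adjoint, and the
modulus `B` of `S` is invertible, with inverse the modulus of `star S`. -/
theorem exists_polar_of_mul_self_eq_one {A : Type*} [CStarAlgebra A] [PartialOrder A]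
    [StarOrderedRing A] {S : A} (hS : S * S = 1) :
    ∃ U B C : A, IsSelfAdjoint U ∧ U * U = 1 ∧ U * B = S ∧ 0 ≤ B ∧ 0 ≤ C ∧ B * C = 1 ∧ C * B = 1 ∧
      B * B = star S * S ∧ C * C = S * star S := by
  have hS' : star S * star S = 1 := by rw [← star_mul, hS, star_one]
  have hT : 0 ≤ star S * S := star_mul_self_nonneg S
  set B : A := CFC.sqrt (star S * S)
  have hB0 : 0 ≤ B := CFC.sqrt_nonneg _
  have hBB : B * B = star S * S := CFC.sqrt_mul_sqrt_self _ hT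
  have hr : B * (B * (S * star S)) = 1 := by
    rw [← mul_assoc, hBB, mul_assoc, ← mul_assoc S S, hS, one_mul, hS']
  have hl : ((S * star S) * B) * B = 1 := by
    rw [mul_assoc, hBB, mul_assoc, ← mul_assoc (star S) (star S), hS', one_mul, hS]
  set C : A := B * (S * star S)
  have hC' : (S * star S) * B = C := left_inv_eq_right_inv hl hr
  have hCB : C * B = 1 := by rw [← hC', hl]
  have hCC : C * C = S * star S := by
    calc C * C = S * star S * B * C := by rw [hC']
      _ = S * star S := by rw [mul_assoc, hr, mul_one]
  have hC0 : 0 ≤ C := CFC.inv_nonneg_of_nonneg (⟨B, C, hr, hCB⟩ : Aˣ) hB0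
  -- Both sides are positive square roots of `S * star S`, hence equal; this makes `U = S * C`
  -- self-adjoint.
  have hconj : S * C * star S = C := by
    have h1 : 0 ≤ S * C * star S := star_right_conjugate_nonneg hC0 S
    have h2 : (S * C * star S) * (S * C * star S) = S * star S := by
      calc _ = S * (C * (star S * S) * C) * star S := by noncomm_ring
        _ = S * star S := by rw [← hBB, ← mul_assoc C B B, hCB, one_mul, mul_assoc S, hr, one_mul]
    rw [← CFC.sqrt_unique h2, CFC.sqrt_unique hCC]
  have hU : S * C = C * star S := by
    calc S * C = S * C * (star S * star S) := by rw [hS', mul_one]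
      _ = C * star S := by rw [← mul_assoc, hconj]
  refine ⟨S * C, B, C, ?_, ?_, ?_, hB0, hC0, hr, hCB, hBB, hCC⟩
  · rw [IsSelfAdjoint, star_mul, (IsSelfAdjoint.of_nonneg hC0).star_eq, hU]
  · calc S * C * (S * C) = S * C * (C * star S) := by rw [← hU]
      _ = S * (C * C) * star S := by noncomm_ring
      _ = 1 := by rw [hCC, ← mul_assoc, hS, one_mul, hS']
  · rw [mul_assoc, hCB, mul_one]

/-- The spectrum of `B` lies in `[1/N, N]`, and `1 - 1/N ≤ N - 1`. -/
theorem norm_one_sub_le_of_mul_eq_one {A : Type*} [CStarAlgebra A] [PartialOrder A]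
    [StarOrderedRing A] [Nontrivial A] {B C : A} (hB : 0 ≤ B) (hBC : B * C = 1) (hCB : C * B = 1)
    {N : ℝ} (hN : 1 ≤ N) (hBN : ‖B‖ ≤ N) (hCN : ‖C‖ ≤ N) : ‖1 - B‖ ≤ N - 1 := by
  have hBsa : IsSelfAdjoint B := .of_nonneg hB
  have h : 1 - B = cfc (fun x : ℝ => 1 - x) B := by
    rw [cfc_sub .., cfc_const_one ℝ B, cfc_id' ℝ B]
  rw [h]
  refine norm_cfc_le (by linarith) fun x hx => ?_
  have h1 : ‖x‖ ≤ N := (spectrum.norm_le_norm_of_mem hx).trans hBN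
  have h0 : 0 ≤ x := spectrum_nonneg_of_nonneg hB hx
  let u : Aˣ := ⟨B, C, hBC, hCB⟩
  have hx0 : x ≠ 0 := by
    rintro rfl
    exact spectrum.zero_notMem ℝ u.isUnit hx
  have hx' : x⁻¹ ∈ spectrum ℝ C :=
    (spectrum.inv_mem_iff (r := Units.mk0 x hx0) (a := u)).mp hx
  have h2 : ‖x⁻¹‖ ≤ N := (spectrum.norm_le_norm_of_mem hx').trans hCN
  have hpos : 0 < x := lt_of_le_of_ne h0 (Ne.symm hx0)
  rw [Real.norm_of_nonneg (by positivity)] at h1 h2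
  have h3 : 1 ≤ N * x := by
    rw [inv_eq_one_div, div_le_iff₀ hpos] at h2; exact h2
  rw [Real.norm_eq_abs, abs_le]
  constructor
  · linarith
  · nlinarith

/-- For an idempotent `Q` there is a projection at distance at most `(‖2Q - 1‖ - 1) / 2`. -/
theorem IsIdempotentElem.exists_isStarProjection_norm_sub_le {A : Type*} [CStarAlgebra A]
    [PartialOrder A] [StarOrderedRing A] [Nontrivial A] {Q : A} (hQ : IsIdempotentElem Q) :
    ∃ P : A, IsStarProjection P ∧ 2 * ‖P - Q‖ ≤ ‖2 * Q - 1‖ - 1 := by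
  have hS : (2 * Q - 1) * (2 * Q - 1) = 1 := by
    have : (2 * Q - 1) * (2 * Q - 1) = 4 * (Q * Q) - 4 * Q + 1 := by noncomm_ring
    rw [this, hQ.eq]; simp
  obtain ⟨U, B, C, hU, hUU, hUB, hB, hC, hBC, hCB, hBB, hCC⟩ := exists_polar_of_mul_self_eq_one hS
  set S := 2 * Q - 1 with hSdef
  have hN : 1 ≤ ‖S‖ := by
    have := norm_mul_le S S
    rw [hS, norm_one] at this
    nlinarith [norm_nonneg S]
  have hBn : ‖B‖ = ‖S‖ := by
    have h : ‖B‖ * ‖B‖ = ‖S‖ * ‖S‖ := by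
      rw [← CStarRing.norm_star_mul_self, ← CStarRing.norm_star_mul_self (x := S),
        (IsSelfAdjoint.of_nonneg hB).star_eq, hBB]
    exact (mul_self_inj (norm_nonneg _) (norm_nonneg _)).mp h
  have hCn : ‖C‖ = ‖S‖ := by
    have h : ‖C‖ * ‖C‖ = ‖S‖ * ‖S‖ := by
      rw [← CStarRing.norm_star_mul_self, ← CStarRing.norm_self_mul_star (x := S),
        (IsSelfAdjoint.of_nonneg hC).star_eq, hCC]
    exact (mul_self_inj (norm_nonneg _) (norm_nonneg _)).mp h
  have hUn : ‖U‖ = 1 := CStarRing.norm_of_mem_unitary (Unitary.mem_iff.mpr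
    ⟨by rw [hU.star_eq, hUU], by rw [hU.star_eq, hUU]⟩)
  have h1B := norm_one_sub_le_of_mul_eq_one hB hBC hCB hN hBn.le hCn.le
  refine ⟨(2⁻¹ : ℝ) • (1 + U), ⟨?_, ?_⟩, ?_⟩
  · rw [IsIdempotentElem, smul_mul_smul_comm, add_mul, mul_add, mul_add, hUU]
    simp only [mul_one, one_mul]
    module
  · exact IsSelfAdjoint.smul (.all _) ((IsSelfAdjoint.one A).add hU)
  · have h : (2 : ℝ) • ((2⁻¹ : ℝ) • (1 + U) - Q) = U * (1 - B) := by
      rw [mul_sub, hUB, hSdef, mul_one, two_mul]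
      module
    calc 2 * ‖(2⁻¹ : ℝ) • (1 + U) - Q‖ = ‖U * (1 - B)‖ := by
          rw [← h, norm_smul, Real.norm_of_nonneg zero_le_two]
      _ ≤ ‖U‖ * ‖1 - B‖ := norm_mul_le _ _
      _ ≤ ‖S‖ - 1 := by rw [hUn, one_mul]; exact h1B

theorem IsStarProjection.norm_two_mul_sub_one {A : Type*} [CStarAlgebra A] [Nontrivial A] {P : A}
    (hP : IsStarProjection P) : ‖2 * P - 1‖ = 1 := by
  have h : (2 * P - 1) * (2 * P - 1) = 1 := by
    have : (2 * P - 1) * (2 * P - 1) = 4 * (P * P) - 4 * P + 1 := by noncomm_ring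
    rw [this, hP.isIdempotentElem.eq]; simp
  have hs : star (2 * P - 1) = 2 * P - 1 := by
    simp [two_mul, hP.isSelfAdjoint.star_eq]
  exact CStarRing.norm_of_mem_unitary (Unitary.mem_iff.mpr ⟨by rw [hs, h], by rw [hs, h]⟩)

theorem theorem2p4 {H : Type*} [NormedAddCommGroup H] [InnerProductSpace ℂ H] [CompleteSpace H]
    [Nontrivial H] (Q P₀ : H →L[ℂ] H) (hQ : IsIdempotentElem Q) (hP₀ : IsStarProjection P₀)
    (hmin : IsLeast {d : ℝ | ∃ P : H →L[ℂ] H, IsStarProjection P ∧ d = ‖P - Q‖} ‖P₀ - Q‖) :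
    ‖1 - P₀ - Q‖ = 1 + ‖P₀ - Q‖ ∧
      IsGreatest {d : ℝ | ∃ P : H →L[ℂ] H, IsStarProjection P ∧ d = ‖P - Q‖} ‖1 - P₀ - Q‖ := by
  obtain ⟨P, hP, hPQ⟩ := hQ.exists_isStarProjection_norm_sub_le
  have hle : ‖P₀ - Q‖ ≤ ‖P - Q‖ := hmin.2 ⟨P, hP, rfl⟩
  have hsum : ‖2 * Q - 1‖ ≤ ‖P₀ - Q‖ + ‖1 - P₀ - Q‖ := by
    rw [show 2 * Q - 1 = -((P₀ - Q) + (1 - P₀ - Q)) by noncomm_ring, norm_neg]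
    exact norm_add_le _ _
  have hdiff : ‖1 - P₀ - Q‖ ≤ 1 + ‖P₀ - Q‖ := by
    rw [← hP₀.norm_two_mul_sub_one,
      show 1 - P₀ - Q = (P₀ - Q) - (2 * P₀ - 1) by noncomm_ring, add_comm]
    exact norm_sub_le _ _
  -- The bounds force `‖2Q - 1‖ = 1 + 2‖P₀ - Q‖`, so the bound `(1 + ‖2Q - 1‖)/2` on every `‖R - Q‖`
  -- is attained at `1 - P₀`.
  refine ⟨by linarith, ⟨1 - P₀, hP₀.one_sub, rfl⟩, ?_⟩
  rintro _ ⟨R, hR, rfl⟩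
  have hupper : 2 * ‖R - Q‖ ≤ 1 + ‖2 * Q - 1‖ := by
    calc 2 * ‖R - Q‖ = ‖(2 : ℝ) • (R - Q)‖ := by
          rw [norm_smul, Real.norm_of_nonneg zero_le_two]
      _ = ‖(2 * R - 1) - (2 * Q - 1)‖ := by
          congr 1
          rw [two_mul, two_mul]
          module
      _ ≤ ‖2 * R - 1‖ + ‖2 * Q - 1‖ := norm_sub_le _ _
      _ = 1 + ‖2 * Q - 1‖ := by rw [hR.norm_two_mul_sub_one]
  linarith
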